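/- **Theorem 2.9.** A family $\mathcal B$ of open subsets of a topological space has the *FNS property* if there is a map $s:\mathcal B\to[\mathcal B]^{<\omega}$ into the finite subsets of $\mathcal B$ such that for all disjoint $U,V\in\mathcal B$ there are disjoint sets $W_U,W_V\in s(U)\cap s(V)$ with $U\subseteq W_U$ and $V\subseteq W_V$. A *cozero-set* of a space $X$ is a set of the form $\{x\in X: f(x)\neq 0\}$ with $f:X\to\mathbb R$ continuous. Let $X$ be a 0-dimensional compact space, i.e. a compact space whose clopen subsets form a base (no separation axiom is assumed). If some base of $X$ consisting of cozero-sets has the FNS property, then the family $\operatorname{Clop}(X)$ of all clopen subsets of $X$ has the FNS property. -/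

import Mathlib

/-- `U` is a cozero-set: the set of points where some continuous real-valued function on `X`
does not vanish. -/
def IsCozeroSet {X : Type*} [TopologicalSpace X] (U : Set X) : Prop :=
  ∃ f : X → ℝ, Continuous f ∧ U = {x | f x ≠ 0}

/-- The family `B` of subsets of `X` has the FNS property: there is a map `s` from `B` to the
finite subsets of `B` such that any two disjoint `U, V ∈ B` have disjoint supersets
`W_U, W_V ∈ s U ∩ s V`. -/
def HasFNS {X : Type*} (B : Set (Set X)) : Prop :=
  ∃ s : B → Finset B, ∀ U V : B, Disjoint (U : Set X) (V : Set X) →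
    ∃ WU WV : B, (WU ∈ s U ∧ WU ∈ s V) ∧ (WV ∈ s U ∧ WV ∈ s V) ∧
      Disjoint (WU : Set X) (WV : Set X) ∧ (U : Set X) ⊆ WU ∧ (V : Set X) ⊆ WV

/-- `X` is 0-dimensional: its clopen sets form a base. -/
def IsZeroDimensional (X : Type*) [TopologicalSpace X] : Prop :=
  TopologicalSpace.IsTopologicalBasis {U : Set X | IsClopen U}

open TopologicalSpace

section Cozero

variable {X : Type*} [TopologicalSpace X]

/-! A clopen `U` is compact, hence a finite union of base members; collecting the FNS values of
these gives a finite `F U ⊆ B`. Disjoint clopen `U`, `V` are separated by lattice combinations `W`,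
`W'` of `F U ∩ F V`, which are cozero but need not be clopen. Each cozero-set has a countable clopen
exhaustion `c W`. If `N U` bounds the indices at which the exhaustions of the relevant `W ⊇ U`
swallow `U`, then whichever of `U`, `V` has the smaller bound is swallowed at an index admissible
for both, which gives a clopen set assigned to both that splits them. -/

theorem IsCozeroSet.sInter {F : Set (Set X)} (hF : F.Finite) (h : ∀ U ∈ F, IsCozeroSet U) :
    IsCozeroSet (⋂₀ F) := by
  induction F, hF using Set.Finite.induction_on with
  | empty => exact ⟨fun _ => 1, continuous_const, by simp⟩
  | @insert U F _ _ ih =>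
    obtain ⟨f, hf, hU⟩ := h U (Set.mem_insert _ _)
    obtain ⟨g, hg, hF⟩ := ih fun V hV => h V (Set.mem_insert_of_mem _ hV)
    refine ⟨fun x => f x * g x, hf.mul hg, ?_⟩
    rw [Set.sInter_insert, hU, hF]
    ext x
    simp

theorem IsCozeroSet.sUnion {F : Set (Set X)} (hF : F.Finite) (h : ∀ U ∈ F, IsCozeroSet U) :
    IsCozeroSet (⋃₀ F) := by
  induction F, hF using Set.Finite.induction_on with
  | empty => exact ⟨fun _ => 0, continuous_const, by simp⟩
  | @insert U F _ _ ih =>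
    obtain ⟨f, hf, hU⟩ := h U (Set.mem_insert _ _)
    obtain ⟨g, hg, hF⟩ := ih fun V hV => h V (Set.mem_insert_of_mem _ hV)
    refine ⟨fun x => |f x| + |g x|, hf.abs.add hg.abs, ?_⟩
    rw [Set.sUnion_insert, hU, hF]
    ext x
    have := add_eq_zero_iff_of_nonneg (abs_nonneg (f x)) (abs_nonneg (g x))
    simp only [abs_eq_zero] at this
    simp only [Set.mem_union, Set.mem_ofPred_eq, ne_eq, this]
    tauto

theorem IsZeroDimensional.exists_isClopen_between (hX : IsZeroDimensional X) {K U : Set X}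
    (hK : IsCompact K) (hU : IsOpen U) (hKU : K ⊆ U) :
    ∃ C, IsClopen C ∧ K ⊆ C ∧ C ⊆ U := by
  refine hK.induction_on (p := fun K => ∃ C, IsClopen C ∧ K ⊆ C ∧ C ⊆ U)
    ⟨∅, isClopen_empty, subset_rfl, Set.empty_subset _⟩ ?_ ?_ ?_
  · rintro s t hst ⟨C, hC, htC, hCU⟩
    exact ⟨C, hC, hst.trans htC, hCU⟩
  · rintro s t ⟨C, hC, hsC, hCU⟩ ⟨D, hD, htD, hDU⟩
    exact ⟨C ∪ D, hC.union hD, Set.union_subset_union hsC htD, Set.union_subset hCU hDU⟩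
  · intro x hx
    obtain ⟨C, hC, hxC, hCU⟩ := hX.exists_subset_of_mem_open (hKU hx) hU
    exact ⟨C, mem_nhdsWithin_of_mem_nhds (hC.isOpen.mem_nhds hxC), C, hC, subset_rfl, hCU⟩

/-- In a zero-dimensional compact space, a cozero-set is exhausted by a sequence of clopen sets
absorbing every compact subset. -/
theorem IsCozeroSet.exists_isClopen_exhaustion [CompactSpace X] (hX : IsZeroDimensional X)
    {W : Set X} (hW : IsCozeroSet W) :
    ∃ c : ℕ → Set X, (∀ n, IsClopen (c n)) ∧ (∀ n, c n ⊆ W) ∧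
      ∀ K, IsCompact K → K ⊆ W → ∃ n, K ⊆ c n := by
  obtain ⟨f, hf, rfl⟩ := hW
  have hopen : IsOpen {x | f x ≠ 0} := isOpen_ne_fun hf continuous_const
  have hpos (n : ℕ) : (0 : ℝ) < 1 / (n + 1) := Nat.one_div_pos_of_nat
  -- These closed sets absorb every compact `K ⊆ W`, because `|f|` has a positive minimum on a
  -- nonempty `K`.
  have key (n : ℕ) : ∃ C, IsClopen C ∧ {x | 1 / (n + 1 : ℝ) ≤ |f x|} ⊆ C ∧ C ⊆ {x | f x ≠ 0} :=
    hX.exists_isClopen_between (isClosed_le continuous_const hf.abs).isCompact hopen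
      fun x hx => abs_pos.1 ((hpos n).trans_le hx)
  choose c hc hcl hcW using key
  refine ⟨c, hc, hcW, fun K hK hKW => ?_⟩
  rcases K.eq_empty_or_nonempty with rfl | hne
  · exact ⟨0, Set.empty_subset _⟩
  obtain ⟨x, hx, hmin⟩ := hK.exists_isMinOn hne hf.abs.continuousOn
  obtain ⟨n, hn⟩ := exists_nat_one_div_lt (abs_pos.2 (hKW hx))
  exact ⟨n, fun y hy => hcl n (hn.le.trans (hmin hy))⟩

end Cozero

/-- The finite unions of finite intersections of members of `F`. -/
def latticeCombinations {α : Type*} (F : Set (Set α)) : Set (Set α) :=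
  (fun T : Set (Set (Set α)) => ⋃₀ (Set.sInter '' T)) '' 𝒫 (𝒫 F)

section LatticeCombinations

variable {α : Type*} {F G : Set (Set α)}

theorem latticeCombinations_finite (hF : F.Finite) : (latticeCombinations F).Finite :=
  hF.powerset.powerset.image _

theorem latticeCombinations_mono (h : F ⊆ G) : latticeCombinations F ⊆ latticeCombinations G :=
  Set.image_mono (Set.powerset_mono.2 (Set.powerset_mono.2 h))

theorem isCozeroSet_of_mem_latticeCombinations [TopologicalSpace α] (hF : F.Finite)
    (h : ∀ U ∈ F, IsCozeroSet U) {W : Set α} (hW : W ∈ latticeCombinations F) :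
    IsCozeroSet W := by
  obtain ⟨T, hT, rfl⟩ := hW
  refine IsCozeroSet.sUnion ((hF.powerset.subset hT).image _) ?_
  rintro _ ⟨S, hS, rfl⟩
  exact IsCozeroSet.sInter (hF.subset (hT hS)) fun U hU => h U (hT hS hU)

/-- The union over `u ∈ U` of the intersections of all members of `F` containing `u`. -/
theorem setOf_exists_forall_mem_latticeCombinations (F : Set (Set α)) (U : Set α) :
    {x | ∃ u ∈ U, ∀ W ∈ F, u ∈ W → x ∈ W} ∈ latticeCombinations F := by
  refine ⟨(fun u => {W ∈ F | u ∈ W}) '' U, ?_, ?_⟩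
  · rintro _ ⟨u, -, rfl⟩
    exact Set.sep_subset _ _
  · ext x
    simp

/-- If `F` separates the points of `U` from those of `V`, then lattice combinations of members
of `F` separate `U` from `V`. -/
theorem exists_disjoint_mem_latticeCombinations {U V : Set α}
    (h : ∀ u ∈ U, ∀ v ∈ V, ∃ W ∈ F, ∃ W' ∈ F, Disjoint W W' ∧ u ∈ W ∧ v ∈ W') :
    ∃ W ∈ latticeCombinations F, ∃ W' ∈ latticeCombinations F,
      Disjoint W W' ∧ U ⊆ W ∧ V ⊆ W' := by
  -- A common point would lie in every member of `F` around some `u ∈ U` and in every one around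
  -- some `v ∈ V`, hence in two disjoint members.
  refine ⟨_, setOf_exists_forall_mem_latticeCombinations F U,
    _, setOf_exists_forall_mem_latticeCombinations F V, ?_,
    fun u hu => ⟨u, hu, fun _ _ h => h⟩, fun v hv => ⟨v, hv, fun _ _ h => h⟩⟩
  rw [Set.disjoint_left]
  rintro x ⟨u, hu, hxu⟩ ⟨v, hv, hxv⟩
  obtain ⟨W, hW, W', hW', hd, huW, hvW⟩ := h u hu v hv
  exact Set.disjoint_left.1 hd (hxu W hW huW) (hxv W' hW' hvW)

end LatticeCombinations

/-- Compact open sets are finite unions of members of a base, so an FNS map on a base induces an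
assignment of finite sets of base members to them, whose lattice combinations separate disjoint
compact open sets. -/
theorem HasFNS.exists_separating_latticeCombinations {X : Type*} [TopologicalSpace X]
    {B : Set (Set X)} (hB : IsTopologicalBasis B) (hs : HasFNS B) :
    ∃ F : Set X → Set (Set X), (∀ U, (F U).Finite) ∧ (∀ U, F U ⊆ B) ∧
      ∀ U V, IsCompact U → IsOpen U → IsCompact V → IsOpen V → Disjoint U V →
        ∃ W ∈ latticeCombinations (F U ∩ F V), ∃ W' ∈ latticeCombinations (F U ∩ F V),
          Disjoint W W' ∧ U ⊆ W ∧ V ⊆ W' := by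
  obtain ⟨s, hs⟩ := hs
  have key (U : Set X) : ∃ T : Set B, T.Finite ∧
      (IsCompact U → IsOpen U → U = ⋃ A ∈ T, (A : Set X)) := by
    by_cases hU : IsCompact U ∧ IsOpen U
    · obtain ⟨T, hT, h⟩ := eq_finite_iUnion_of_isTopologicalBasis_of_isCompact_open
        (fun A : B => (A : Set X)) (by simpa using hB) U hU.1 hU.2
      exact ⟨T, hT, fun _ _ => h⟩
    · exact ⟨∅, Set.finite_empty, fun h₁ h₂ => (hU ⟨h₁, h₂⟩).elim⟩
  choose T hT hcov using key
  refine ⟨fun U => Subtype.val '' ⋃ A ∈ T U, (s A : Set B),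
    fun U => ((hT U).biUnion fun A _ => (s A).finite_toSet).image _,
    fun U => by rintro _ ⟨A, -, rfl⟩; exact A.2, fun U V hU hU' hV hV' hUV => ?_⟩
  refine exists_disjoint_mem_latticeCombinations fun u hu v hv => ?_
  have hu' := hu
  have hv' := hv
  rw [hcov U hU hU'] at hu'
  rw [hcov V hV hV'] at hv'
  obtain ⟨A, hA, huA⟩ := Set.mem_iUnion₂.1 hu'
  obtain ⟨C, hC, hvC⟩ := Set.mem_iUnion₂.1 hv'
  have hAU : (A : Set X) ⊆ U := by
    rw [hcov U hU hU']
    exact Set.subset_biUnion_of_mem (u := fun A : B => (A : Set X)) hA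
  have hCV : (C : Set X) ⊆ V := by
    rw [hcov V hV hV']
    exact Set.subset_biUnion_of_mem (u := fun A : B => (A : Set X)) hC
  obtain ⟨W, W', ⟨hWA, hWC⟩, ⟨hWA', hWC'⟩, hd, hAW, hCW⟩ := hs A C (hUV.mono hAU hCV)
  exact ⟨W, ⟨⟨W, Set.mem_biUnion hA hWA, rfl⟩, ⟨W, Set.mem_biUnion hC hWC, rfl⟩⟩,
    W', ⟨⟨W', Set.mem_biUnion hA hWA', rfl⟩, ⟨W', Set.mem_biUnion hC hWC', rfl⟩⟩,
    hd, hAW huA, hCW hvC⟩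

/-- To show that the clopen sets have the FNS property it suffices to split disjoint clopen
sets by a clopen set taken from finite sets assigned to both. -/
theorem hasFNS_isClopen_of_exists_split {X : Type*} [TopologicalSpace X]
    (t : Set X → Set (Set X)) (ht : ∀ U, IsClopen U → (t U).Finite)
    (htc : ∀ U, ∀ C ∈ t U, IsClopen C)
    (h : ∀ U V, IsClopen U → IsClopen V → Disjoint U V →
      ∃ C ∈ t U ∩ t V, (U ⊆ C ∧ Disjoint C V) ∨ (V ⊆ C ∧ Disjoint C U)) :
    HasFNS {U : Set X | IsClopen U} := by
  -- Closing under complements makes one splitting set `C` enough: `C` and `Cᶜ` are the disjoint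
  -- supersets.
  have hfin (U : {U : Set X | IsClopen U}) :
      {C : {U : Set X | IsClopen U} | (C : Set X) ∈ t U ∪ compl '' t U}.Finite :=
    ((ht U U.2).union ((ht U U.2).image _)).preimage Subtype.val_injective.injOn
  refine ⟨fun U => (hfin U).toFinset, fun U V hUV => ?_⟩
  obtain ⟨C, ⟨hCU, hCV⟩, hC⟩ := h U V U.2 V.2 hUV
  have hCc : IsClopen C := htc U C hCU
  let C₁ : {U : Set X | IsClopen U} := ⟨C, hCc⟩
  let C₂ : {U : Set X | IsClopen U} := ⟨Cᶜ, hCc.compl⟩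
  have h₁ : C₁ ∈ (hfin U).toFinset ∧ C₁ ∈ (hfin V).toFinset := by
    simp only [Set.Finite.mem_toFinset]
    exact ⟨Or.inl hCU, Or.inl hCV⟩
  have h₂ : C₂ ∈ (hfin U).toFinset ∧ C₂ ∈ (hfin V).toFinset := by
    simp only [Set.Finite.mem_toFinset]
    exact ⟨Or.inr ⟨C, hCU, rfl⟩, Or.inr ⟨C, hCV, rfl⟩⟩
  rcases hC with ⟨hUC, hd⟩ | ⟨hVC, hd⟩
  · exact ⟨C₁, C₂, h₁, h₂, disjoint_compl_right, hUC, Set.subset_compl_iff_disjoint_left.2 hd⟩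
  · exact ⟨C₂, C₁, h₂, h₁, disjoint_compl_left, Set.subset_compl_iff_disjoint_left.2 hd, hVC⟩

theorem theorem2p9 {X : Type*} [TopologicalSpace X] [CompactSpace X]
    (hX : IsZeroDimensional X)
    (hB : ∃ B : Set (Set X), TopologicalSpace.IsTopologicalBasis B ∧
      (∀ U ∈ B, IsCozeroSet U) ∧ HasFNS B) :
    HasFNS {U : Set X | IsClopen U} := by
  obtain ⟨B, hB, hcoz, hs⟩ := hB
  obtain ⟨F, hF, hFB, hsep⟩ := hs.exists_separating_latticeCombinations hB
  -- The exhaustion depends on `W` alone, so `U` and `V` share the same `c W n`.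
  have hexh (W : Set X) : ∃ c : ℕ → Set X, (∀ n, IsClopen (c n)) ∧ (IsCozeroSet W →
      (∀ n, c n ⊆ W) ∧ ∀ K, IsCompact K → K ⊆ W → ∃ n, K ⊆ c n) := by
    by_cases hW : IsCozeroSet W
    · obtain ⟨c, hc, h⟩ := hW.exists_isClopen_exhaustion hX
      exact ⟨c, hc, fun _ => h⟩
    · exact ⟨fun _ => ∅, fun _ => isClopen_empty, fun h => (hW h).elim⟩
  choose c hc hcW using hexh
  have hLcoz (U : Set X) {W} (hW : W ∈ latticeCombinations (F U)) : IsCozeroSet W :=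
    isCozeroSet_of_mem_latticeCombinations (hF U) (fun A hA => hcoz A (hFB U hA)) hW
  -- The exhaustion need not be increasing, so the index is only bounded by `N`, not taken equal to
  -- it.
  have hbound (U : Set X) : ∃ N : ℕ, IsClopen U → ∀ W ∈ latticeCombinations (F U), U ⊆ W →
      ∃ n ≤ N, U ⊆ c W n := by
    have hn (W : Set X) : ∃ n, IsClopen U → W ∈ latticeCombinations (F U) → U ⊆ W →
        U ⊆ c W n := by
      by_cases h : IsClopen U ∧ W ∈ latticeCombinations (F U) ∧ U ⊆ W
      · obtain ⟨n, hn⟩ := (hcW W (hLcoz U h.2.1)).2 U h.1.isClosed.isCompact h.2.2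
        exact ⟨n, fun _ _ _ => hn⟩
      · exact ⟨0, fun h₁ h₂ h₃ => (h ⟨h₁, h₂, h₃⟩).elim⟩
    choose n hn using hn
    obtain ⟨N, hN⟩ := ((latticeCombinations_finite (hF U)).image n).bddAbove
    exact ⟨N, fun hU W hW hUW => ⟨n W, hN ⟨W, hW, rfl⟩, hn W hU hW hUW⟩⟩
  choose N hN using hbound
  have split {U V W W' : Set X} (hU : IsClopen U) (hUV : N U ≤ N V)
      (hW : W ∈ latticeCombinations (F U ∩ F V)) (hd : Disjoint W W') (hUW : U ⊆ W)
      (hVW : V ⊆ W') : ∃ n, n ≤ N U ∧ n ≤ N V ∧ U ⊆ c W n ∧ Disjoint (c W n) V := by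
    have hWU := latticeCombinations_mono Set.inter_subset_left hW
    obtain ⟨n, hn, hUc⟩ := hN U hU W hWU hUW
    exact ⟨n, hn, hn.trans hUV, hUc, hd.mono ((hcW W (hLcoz U hWU)).1 n) hVW⟩
  refine hasFNS_isClopen_of_exists_split
    (fun U => Set.image2 c (latticeCombinations (F U)) (Set.Iic (N U)))
    (fun U _ => (latticeCombinations_finite (hF U)).image2 _ (Set.finite_Iic _)) ?_ ?_
  · rintro U _ ⟨W, -, n, -, rfl⟩
    exact hc W n
  · intro U V hU hV hUV
    obtain ⟨W, hW, W', hW', hd, hUW, hVW⟩ := hsep U V hU.isClosed.isCompact hU.isOpen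
      hV.isClosed.isCompact hV.isOpen hUV
    have mem {W : Set X} {n : ℕ} (hW : W ∈ latticeCombinations (F U ∩ F V)) (hnU : n ≤ N U)
        (hnV : n ≤ N V) : c W n ∈ Set.image2 c (latticeCombinations (F U)) (Set.Iic (N U)) ∩
          Set.image2 c (latticeCombinations (F V)) (Set.Iic (N V)) :=
      ⟨⟨W, latticeCombinations_mono Set.inter_subset_left hW, n, hnU, rfl⟩,
        ⟨W, latticeCombinations_mono Set.inter_subset_right hW, n, hnV, rfl⟩⟩
    -- The set with the smaller bound is the one enclosed; the other is only kept disjoint, which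
    -- needs no index.
    rcases le_total (N U) (N V) with hle | hle
    · obtain ⟨n, hnU, hnV, hUc, hcV⟩ := split hU hle hW hd hUW hVW
      exact ⟨c W n, mem hW hnU hnV, Or.inl ⟨hUc, hcV⟩⟩
    · rw [Set.inter_comm] at hW'
      obtain ⟨n, hnV, hnU, hVc, hcU⟩ := split hV hle hW' hd.symm hVW hUW
      rw [Set.inter_comm] at hW'
      exact ⟨c W' n, mem hW' hnU hnV, Or.inr ⟨hVc, hcU⟩⟩
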